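/- For $n\ge 1$ consider the Ising model with zero magnetic field on the periodic cubic lattice $\mathbb Z_n^3$ with $N=n^3$ sites: spins $\sigma_i=\pm1$, energy $\mathcal H_N=-J\sum_{\langle i,j\rangle}\sigma_i\sigma_j$ (sum over unordered pairs of distinct nearest neighbours on the torus), partition function $Z_N=\sum_{\{\sigma\}}e^{-\beta\mathcal H_N}$ and expectation values $\langle A\rangle_N=Z_N^{-1}\sum_{\{\sigma\}}A\,e^{-\beta\mathcal H_N}$, where $\beta,J$ may be complex. Let $t=\tanh(\beta J)$ and $r_0=(\sqrt3-\sqrt2)(\sqrt2-1)$. Fix sites $j_1,\dots,j_m\in\mathbb Z^3$ ($m\ge 0$), read modulo $n$ on $\mathbb Z_n^3$, and let $d$ be the largest edge of the minimal axis-parallel box containing them, i.e. the largest difference of two of them in one coordinate ($d=0$ if $m=0$). Then: (a) If $\cosh(\beta J)\ne0$ and $|t|<r_0$, or if $|\beta J|<\arctan r_0$, then $Z_N\ne0$ for all $N=n^3$, and the thermodynamic limit $\langle\prod_{i=1}^m\sigma_{j_i}\rangle_\infty=\lim_{N\to\infty}\langle\prod_{i=1}^m\sigma_{j_i}\rangle_N$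 exists. (b) For every $N=n^3$ and for $N=\infty$, the correlation function $\langle\prod_{i=1}^m\sigma_{j_i}\rangle_N$ is an analytic function of $t$ in the disc $|t|<r_0$, equal there to the sum of a power series $\sum_k c_k^{(N)}t^k$ with radius of convergence at least $r_0$; for each $\rho<r_0$ these series converge uniformly in $|t|\le\rho$ and in $N$, including $N=\infty$. Likewise it is an analytic function of $\beta J$ in the disc $|\beta J|<\arctan r_0$, equal there to the sum of a power series in $\beta J$ with radius of convergence at least $\arctan r_0$; for each $\rho<\arctan r_0$ these series converge uniformly in $|\beta J|\le\rho$ and in $N$, including $N=\infty$. (c) If $k<n-d$, then the coefficient $c_k^{(N)}$ of $t^k$ for the lattice with $N=n^3$ sites equals $c_k^{(N')}$ for all larger lattices $N'=n'^3$, $n'\ge n$, and for $N'=\infty$. -/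

import Mathlib

open Filter Topology

noncomputable section

namespace Ising

/-- The sites of the periodic `n × n × n` lattice, i.e. of the discrete 3-torus. -/
abbrev Site (n : ℕ+) : Type := Fin 3 → ZMod n

/-- The nearest-neighbour graph of the periodic lattice: two different sites are adjacent iff
their difference is `(±1,0,0)`, `(0,±1,0)` or `(0,0,±1)` modulo `n`. -/
def torus (n : ℕ+) : SimpleGraph (Site n) where
  Adj i j := i ≠ j ∧ ∃ a : Fin 3, i - j = Pi.single a 1 ∨ i - j = -Pi.single a 1
  symm := ⟨fun i j h => ⟨h.1.symm, h.2.imp fun a ha => ha.symm.imp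
    (fun h => by rw [← neg_sub, h, neg_neg]) (fun h => by rw [← neg_sub, h])⟩⟩
  loopless := ⟨fun _ h => h.1 rfl⟩

instance (n : ℕ+) : DecidableRel (torus n).Adj := fun i j =>
  inferInstanceAs
    (Decidable (i ≠ j ∧ ∃ a : Fin 3, i - j = Pi.single a 1 ∨ i - j = -Pi.single a 1))

/-- Spin configurations: every site carries a spin `1` or `-1`. -/
abbrev Config (n : ℕ+) : Type := Site n → ℤˣ

/-- The spin `σ_i` as a complex number. -/
def spin {n : ℕ+} (σ : Config n) (i : Site n) : ℂ := ((σ i : ℤ) : ℂ)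

/-- The interaction energy `-J ∑_{⟨i,j⟩} σ_i σ_j - B ∑_i σ_i`; the first sum runs over the
unordered pairs of nearest neighbours. -/
def energy (n : ℕ+) (J B : ℂ) (σ : Config n) : ℂ :=
  -J * ∑ e ∈ (torus n).edgeFinset, (e.map (spin σ)).mul - B * ∑ i, spin σ i

/-- The partition function `∑_σ exp (-β H(σ))`. -/
def partitionFunction (n : ℕ+) (β J B : ℂ) : ℂ :=
  ∑ σ : Config n, Complex.exp (-β * energy n J B σ)

/-- The expectation value of a function `A` of the spin configuration. -/
def expectation (n : ℕ+) (β J B : ℂ) (A : Config n → ℂ) : ℂ :=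
  (∑ σ : Config n, A σ * Complex.exp (-β * energy n J B σ)) / partitionFunction n β J B

/-- The site of the periodic lattice given by integer coordinates. -/
def toSite (n : ℕ+) (x : Fin 3 → ℤ) : Site n := fun a => (x a : ZMod n)

/-- The correlation function of the spins at the sites `j 0, …, j (m-1)` (in integer
coordinates) on the lattice with `n ^ 3` sites, and, for `⊤`, its limit as `n → ∞`. -/
def correlation {m : ℕ} (j : Fin m → Fin 3 → ℤ) (β J B : ℂ) : WithTop ℕ+ → ℂ
  | (n : ℕ+) => expectation n β J B fun σ => ∏ i, spin σ (toSite n (j i))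
  | ⊤ => limUnder atTop fun n : ℕ+ =>
      expectation n β J B fun σ => ∏ i, spin σ (toSite n (j i))

/-- The largest edge of the minimal box (with edges parallel to the axes) containing all the
sites: the largest difference of two of them in one coordinate. -/
def boxEdge {m : ℕ} (j : Fin m → Fin 3 → ℤ) : ℕ :=
  Finset.univ.sup fun p : Fin 3 × Fin m × Fin m => (j p.2.1 p.1 - j p.2.2 p.1).natAbs

/-- The functions `f n`, `n = 1, 2, …, ∞`, are the sums on the open disc of radius `r` about `0`
of the power series with coefficients `c n`, which converge uniformly in `n` (`∞` included)
and in the variable in each smaller closed disc. -/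
def IsUniformSeriesExpansion (r : ℝ) (f : WithTop ℕ+ → ℂ → ℂ) (c : WithTop ℕ+ → ℕ → ℂ) : Prop :=
  (∀ n, HasFPowerSeriesOnBall (f n) (FormalMultilinearSeries.ofScalars ℂ (c n)) 0
    (ENNReal.ofReal r)) ∧
  ∀ ρ < r, TendstoUniformlyOn
    (fun (K : ℕ) (p : WithTop ℕ+ × ℂ) => ∑ k ∈ Finset.range K, c p.1 k * p.2 ^ k)
    (fun p => f p.1 p.2) atTop (Set.univ ×ˢ Metric.closedBall 0 ρ)

/-- The bound `(√3 - √2)(√2 - 1)` on `|tanh (β J)|`. -/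
def tBound : ℝ := (√3 - √2) * (√2 - 1)

end Ising

end

noncomputable section

set_option linter.unusedSectionVars false

namespace Ising

/-! ### Products of spins -/

section SpinProd

variable {V : Type*} [DecidableEq V]

/-! Up to a nonvanishing factor, the Boltzmann weight is the product over the edges of `1 + t * s i
* s j`, so everything is a statement about its moments, the sums of products of spins against it.
Measure a density by the largest modulus of its moments. Multiplication by one spin only permutes
the moments, so multiplication by `t * s b` has norm at most `|t|`; the addition theorem of tanh
then shows that multiplication by the tanh of a local field of `k` neighbours has norm at most `tan
(k * arctan |t|)` (`IsMultiplier.addition`, `exists_tanh_multiplier`). Summing over the spin at a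
site of `A` replaces it by such a tanh (`norm_moment_le_mul`). With at most six neighbours and
`arctan tBound = π / 24` the norm is below `tan (π / 4) = 1`, so the empty product has the largest
moment. It cannot vanish, since otherwise all moments, and with them the weight, would vanish.

Hence each finite correlation is holomorphic and bounded by one in `|t| < tBound`, and Cauchy's
estimate bounds its Taylor coefficients uniformly in the lattice size. Multiplying the weight by `∏
(1 - t * s a * s b)` over the neighbours of `a` makes it even in `s a`, which yields a linear
relation expressing a correlation by others with positive powers of `t` in front
(`sum_corr_attach_eq_zero`). Each power of `t` widens the box by at most one, so low-order
coefficients do not feel the size of the torus (`corr_sub_isBigO`). Stable coefficients with a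
common geometric bound give the limit. The inequality `|tanh z| ≤ tan M` for `|z| < M < π / 2`
transfers the results to the variable `β * J`. -/

/-- The product of the spins `s v`, `v ∈ A`, as a complex number. -/
def spinProd (A : Finset V) (s : V → ℤˣ) : ℂ := ∏ v ∈ A, ((s v : ℤ) : ℂ)

lemma intUnit_mul_self (u : ℤˣ) : ((u : ℤ) : ℂ) * ((u : ℤ) : ℂ) = 1 := by
  rcases Int.units_eq_one_or u with rfl | rfl <;> simp

lemma norm_intUnit (u : ℤˣ) : ‖((u : ℤ) : ℂ)‖ = 1 := by
  rcases Int.units_eq_one_or u with rfl | rfl <;> simp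

lemma norm_spinProd (A : Finset V) (s : V → ℤˣ) : ‖spinProd A s‖ = 1 := by
  simp only [spinProd, norm_prod, norm_intUnit, Finset.prod_const_one]

@[simp] lemma spinProd_empty (s : V → ℤˣ) : spinProd ∅ s = 1 := rfl

@[simp] lemma spinProd_singleton (v : V) (s : V → ℤˣ) : spinProd {v} s = ((s v : ℤ) : ℂ) := by
  simp [spinProd]

lemma spinProd_symmDiff (A B : Finset V) (s : V → ℤˣ) :
    spinProd (symmDiff A B) s = spinProd A s * spinProd B s := by
  have key : ∀ C ⊆ A ∪ B, spinProd C s = ∏ v ∈ A ∪ B, if v ∈ C then ((s v : ℤ) : ℂ) else 1 := by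
    intro C hC
    rw [Finset.prod_ite_mem, Finset.inter_eq_right.2 hC, spinProd]
  rw [key A Finset.subset_union_left, key B Finset.subset_union_right,
    key _ symmDiff_le_sup, ← Finset.prod_mul_distrib]
  refine Finset.prod_congr rfl fun v _ => ?_
  by_cases hA : v ∈ A <;> by_cases hB : v ∈ B <;>
    simp [Finset.mem_symmDiff, hA, hB, intUnit_mul_self]

/-- Coinciding sites cancel in pairs because a spin squares to one, so correlations with repeated
sites reduce to those indexed by sets. -/
lemma exists_spinProd_eq_prod {ι : Type*} (I : Finset ι) (j : ι → V) :
    ∃ A : Finset V, A ⊆ I.image j ∧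
      ∀ s : V → ℤˣ, ∏ i ∈ I, ((s (j i) : ℤ) : ℂ) = spinProd A s := by
  classical
  induction I using Finset.induction_on with
  | empty => exact ⟨∅, by simp, by simp⟩
  | insert i I hi ih =>
    obtain ⟨A, hA, h⟩ := ih
    refine ⟨symmDiff {j i} A, ?_, fun s => ?_⟩
    · rw [Finset.image_insert, Finset.insert_eq]
      exact symmDiff_le_sup.trans (Finset.union_subset_union_right hA)
    · rw [Finset.prod_insert hi, h, spinProd_symmDiff, spinProd_singleton]

/-- Reversal of the spin at `a`. -/
def flip (a : V) (s : V → ℤˣ) : V → ℤˣ := Function.update s a (-s a)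

@[simp] lemma flip_self (a : V) (s : V → ℤˣ) : flip a s a = -s a := by simp [flip]

lemma flip_of_ne {a b : V} (h : b ≠ a) (s : V → ℤˣ) : flip a s b = s b := by simp [flip, h]

lemma flip_involutive (a : V) : Function.Involutive (flip a) := by
  intro s
  ext b
  by_cases h : b = a
  · subst h; simp
  · simp [flip_of_ne h]

lemma spinProd_flip_of_notMem {a : V} {A : Finset V} (h : a ∉ A) (s : V → ℤˣ) :
    spinProd A (flip a s) = spinProd A s :=
  Finset.prod_congr rfl fun b hb => by rw [flip_of_ne (ne_of_mem_of_not_mem hb h)]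

variable [Fintype V]

lemma sum_eq_zero_of_odd_involution {e : (V → ℤˣ) → V → ℤˣ} (he : Function.Involutive e)
    {F : (V → ℤˣ) → ℂ} (h : ∀ s, F (e s) = -F s) : ∑ s, F s = 0 := by
  have h1 : ∑ s, F (e s) = ∑ s, F s := Equiv.sum_comp he.toPerm F
  simp only [h, Finset.sum_neg_distrib] at h1
  exact neg_eq_self.1 h1

lemma sum_spinProd_mul_spinProd (s s' : V → ℤˣ) :
    ∑ A, spinProd A s * spinProd A s' = if s' = s then (2 : ℂ) ^ Fintype.card V else 0 := by
  have : ∑ A, spinProd A s * spinProd A s' =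
      ∏ v, (1 + ((s v : ℤ) : ℂ) * ((s' v : ℤ) : ℂ)) := by
    rw [Finset.prod_one_add, Finset.powerset_univ]
    simp only [spinProd, Finset.prod_mul_distrib]
  rw [this]
  split_ifs with h
  · subst h
    simp only [intUnit_mul_self]
    norm_num
  · obtain ⟨v, hv⟩ := Function.ne_iff.1 h
    refine Finset.prod_eq_zero (Finset.mem_univ v) ?_
    rcases Int.units_eq_one_or (s v) with h1 | h1 <;>
      rcases Int.units_eq_one_or (s' v) with h2 | h2 <;> simp_all

/-- The products of spins are the characters of the group of configurations; this is Fourier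
inversion by their orthogonality. -/
lemma eq_zero_of_sum_spinProd_eq_zero {L : (V → ℤˣ) → ℂ}
    (h : ∀ A, ∑ s, spinProd A s * L s = 0) (s : V → ℤˣ) : L s = 0 := by
  have h1 : ∑ A, spinProd A s * ∑ s', spinProd A s' * L s' = 0 := by simp [h]
  simp only [Finset.mul_sum, ← mul_assoc] at h1
  rw [Finset.sum_comm] at h1
  simp only [← Finset.sum_mul, sum_spinProd_mul_spinProd, ite_mul, zero_mul] at h1
  simpa using h1

end SpinProd

/-! ### Multipliers -/

section Multiplier

variable {V : Type*} [DecidableEq V] [Fintype V]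

/-- Multiplication by `F` has norm at most `q` with respect to the norm on densities `L` that is
the supremum over `A` of `|∑ s, spinProd A s * L s|`. -/
def IsMultiplier (F : (V → ℤˣ) → ℂ) (q : ℝ) : Prop :=
  ∀ (L : (V → ℤˣ) → ℂ) (C : ℝ), (∀ A, ‖∑ s, spinProd A s * L s‖ ≤ C) →
    ∀ A, ‖∑ s, spinProd A s * (F s * L s)‖ ≤ q * C

lemma IsMultiplier.norm_le {F : (V → ℤˣ) → ℂ} {q : ℝ} (h : IsMultiplier F q) (s : V → ℤˣ) :
    ‖F s‖ ≤ q := by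
  -- The test density is a point mass, all of whose moments have modulus one.
  have := h (Pi.single s 1) 1 (fun A => by simp [Pi.single_apply, norm_spinProd]) ∅
  simpa [Pi.single_apply] using this

lemma isMultiplier_zero : IsMultiplier (fun _ : V → ℤˣ => 0) 0 := fun L C _ A => by simp

/-- The quotient `F'` satisfies `F' = F + t * s b - t * s b * F * F'`. Applied to the moment of `F'
* L` of largest modulus `C'`, this gives `C' ≤ q * C + |t| * C + |t| * q * C'`, and `q * |t| < 1`
allows solving for `C'`. -/
lemma IsMultiplier.addition {F : (V → ℤˣ) → ℂ} {q : ℝ} (h : IsMultiplier F q) (t : ℂ)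
    (hqt : q * ‖t‖ < 1) (b : V) :
    (∀ s, 1 + t * ((s b : ℤ) : ℂ) * F s ≠ 0) ∧
    IsMultiplier (fun s => (F s + t * ((s b : ℤ) : ℂ)) / (1 + t * ((s b : ℤ) : ℂ) * F s))
      ((q + ‖t‖) / (1 - q * ‖t‖)) := by
  have hne : ∀ s : V → ℤˣ, 1 + t * ((s b : ℤ) : ℂ) * F s ≠ 0 := by
    intro s h0
    have h1 : t * ((s b : ℤ) : ℂ) * F s = -1 := by linear_combination h0
    have h2 := congrArg norm h1
    rw [norm_mul, norm_mul, norm_intUnit, norm_neg, norm_one, mul_one] at h2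
    have := mul_le_mul_of_nonneg_right (h.norm_le s) (norm_nonneg t)
    linarith
  refine ⟨hne, fun L C hL => ?_⟩
  set F' : (V → ℤˣ) → ℂ :=
    fun s => (F s + t * ((s b : ℤ) : ℂ)) / (1 + t * ((s b : ℤ) : ℂ) * F s) with hF'
  obtain ⟨A₀, -, hA₀⟩ := Finset.exists_max_image (Finset.univ : Finset (Finset V))
    (fun A => ‖∑ s, spinProd A s * (F' s * L s)‖) ⟨∅, Finset.mem_univ _⟩
  have hmax := fun A => hA₀ A (Finset.mem_univ A)
  set C' := ‖∑ s, spinProd A₀ s * (F' s * L s)‖ with hC'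
  have hid : ∑ s, spinProd A₀ s * (F' s * L s) =
      ∑ s, spinProd A₀ s * (F s * L s) + t * ∑ s, spinProd (symmDiff A₀ {b}) s * L s
        - t * ∑ s, spinProd (symmDiff A₀ {b}) s * (F s * (F' s * L s)) := by
    rw [Finset.mul_sum, Finset.mul_sum, ← Finset.sum_add_distrib, ← Finset.sum_sub_distrib]
    refine Finset.sum_congr rfl fun s _ => ?_
    have h2 : F' s * (1 + t * ((s b : ℤ) : ℂ) * F s) = F s + t * ((s b : ℤ) : ℂ) :=
      div_mul_cancel₀ _ (hne s)
    rw [spinProd_symmDiff, spinProd_singleton]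
    linear_combination (spinProd A₀ s * L s) * h2
  have hle : C' ≤ q * C + ‖t‖ * C + ‖t‖ * (q * C') := by
    refine (congrArg norm hid).le.trans ?_
    refine (norm_sub_le _ _).trans (add_le_add ((norm_add_le _ _).trans (add_le_add ?_ ?_)) ?_)
    · exact h L C hL A₀
    · rw [norm_mul]; exact mul_le_mul_of_nonneg_left (hL _) (norm_nonneg _)
    · rw [norm_mul]
      exact mul_le_mul_of_nonneg_left (h _ _ hmax _) (norm_nonneg _)
  intro A
  refine (hmax A).trans ?_
  rw [div_mul_eq_mul_div, le_div_iff₀ (by linarith)]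
  nlinarith

/-- The function `tanh (∑ b ∈ S, K * s b)` with `tanh K = t`, and its multiplier bound. -/
lemma exists_tanh_multiplier (t : ℂ) (S : Finset V)
    (hS : S.card * Real.arctan ‖t‖ < Real.pi / 2) :
    ∃ F : (V → ℤˣ) → ℂ, IsMultiplier F (Real.tan (S.card * Real.arctan ‖t‖)) ∧
      (∀ s, (1 - F s) * ∏ b ∈ S, (1 + t * ((s b : ℤ) : ℂ)) =
        (1 + F s) * ∏ b ∈ S, (1 - t * ((s b : ℤ) : ℂ))) ∧
      ∀ s s', (∀ b ∈ S, s b = s' b) → F s = F s' := by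
  -- Neighbours are added one at a time: the bound `(q + |t|) / (1 - q * |t|)` is the addition
  -- theorem of tan. The second property is the cross-multiplied form of `F = (P - Q) / (P + Q)`,
  -- with `P` and `Q` the products of `1 + t * s b` and `1 - t * s b`.
  induction S using Finset.induction_on with
  | empty => exact ⟨fun _ => 0, by simpa using isMultiplier_zero, by simp, by simp⟩
  | insert b S hb ih =>
    have hθ : 0 ≤ Real.arctan ‖t‖ := Real.arctan_nonneg.2 (norm_nonneg t)
    rw [Finset.card_insert_of_notMem hb] at hS ⊢
    push_cast at hS ⊢
    set θ := Real.arctan ‖t‖ with hθdef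
    have ht : Real.tan θ = ‖t‖ := Real.tan_arctan _
    have hkθ : (0 : ℝ) ≤ S.card * θ := by positivity
    have hlt : S.card * θ < Real.pi / 2 := by nlinarith
    have hθlt : θ < Real.pi / 2 := Real.arctan_lt_pi_div_two _
    obtain ⟨F, hF, hF2, hF3⟩ := ih hlt
    have hc1 : 0 < Real.cos (S.card * θ) :=
      Real.cos_pos_of_mem_Ioo ⟨by linarith [Real.pi_pos], hlt⟩
    have hc2 : 0 < Real.cos θ := Real.cos_pos_of_mem_Ioo ⟨by linarith [Real.pi_pos], hθlt⟩
    have hc3 : 0 < Real.cos (S.card * θ + θ) :=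
      Real.cos_pos_of_mem_Ioo ⟨by linarith [Real.pi_pos], by linarith⟩
    rw [Real.cos_add] at hc3
    have hlt1 : Real.tan (S.card * θ) * ‖t‖ < 1 := by
      rw [← ht, Real.tan_eq_sin_div_cos, Real.tan_eq_sin_div_cos, div_mul_div_comm,
        div_lt_one (by positivity)]
      linarith
    obtain ⟨hne, hmul⟩ := hF.addition t hlt1 b
    refine ⟨fun s => (F s + t * ((s b : ℤ) : ℂ)) / (1 + t * ((s b : ℤ) : ℂ) * F s), ?_,
      fun s => ?_, fun s s' hs => ?_⟩
    · convert hmul using 1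
      rw [← ht] at hlt1 ⊢
      rw [add_mul, one_mul, Real.tan_eq_sin_div_cos (_ + _), Real.sin_add, Real.cos_add,
        Real.tan_eq_sin_div_cos, Real.tan_eq_sin_div_cos]
      have : Real.cos (S.card * θ) * Real.cos θ - Real.sin (S.card * θ) * Real.sin θ ≠ 0 :=
        hc3.ne'
      field_simp
    · rw [Finset.prod_insert hb, Finset.prod_insert hb]
      have h1 := hne s
      have h2 := hF2 s
      have h3 : (F s + t * ((s b : ℤ) : ℂ)) / (1 + t * ((s b : ℤ) : ℂ) * F s) *
        (1 + t * ((s b : ℤ) : ℂ) * F s) = F s + t * ((s b : ℤ) : ℂ) := div_mul_cancel₀ _ h1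
      refine mul_left_cancel₀ h1 ?_
      beta_reduce
      generalize (F s + t * ((s b : ℤ) : ℂ)) / (1 + t * ((s b : ℤ) : ℂ) * F s) = y at h3 ⊢
      generalize t * ((s b : ℤ) : ℂ) = x at h3 ⊢
      generalize ∏ b ∈ S, (1 + t * ((s b : ℤ) : ℂ)) = P at h2 ⊢
      generalize ∏ b ∈ S, (1 - t * ((s b : ℤ) : ℂ)) = Q at h2 ⊢
      linear_combination (1 - x) * (1 + x) * h2 - ((1 + x) * P + (1 - x) * Q) * h3
    · have h1 := hF3 s s' fun c hc => hs c (Finset.mem_insert_of_mem hc)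
      simp only [h1, hs b (Finset.mem_insert_self _ _)]

end Multiplier

/-! ### Moments of the Ising weight on a finite graph -/

section Graph

variable {V : Type*} [DecidableEq V] [Fintype V] (G : SimpleGraph V) [DecidableRel G.Adj]

/-- The weight `∏ (1 + t * s i * s j)` over the edges of `G`. -/
def weight (t : ℂ) (s : V → ℤˣ) : ℂ :=
  ∏ e ∈ G.edgeFinset, (1 + t * (e.map fun v => ((s v : ℤ) : ℂ)).mul)

lemma norm_mul_map_intUnit (s : V → ℤˣ) (e : Sym2 V) :
    ‖(e.map fun v => ((s v : ℤ) : ℂ)).mul‖ = 1 := by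
  induction e with
  | _ x y => simp only [Sym2.map_mk, Sym2.mul_mk, norm_mul, norm_intUnit, mul_one]

lemma weight_ne_zero {t : ℂ} (ht : ‖t‖ < 1) (s : V → ℤˣ) : weight G t s ≠ 0 := by
  refine Finset.prod_ne_zero_iff.2 fun e _ h => ?_
  have h1 := congrArg norm (eq_neg_of_add_eq_zero_right h)
  rw [norm_mul, norm_mul_map_intUnit, norm_neg, norm_one, mul_one] at h1
  linarith

lemma weight_zero (s : V → ℤˣ) : weight G 0 s = 1 := by simp [weight]

lemma differentiable_weight (s : V → ℤˣ) : Differentiable ℂ fun t => weight G t s := by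
  unfold weight
  fun_prop

lemma weight_neg (t : ℂ) (s : V → ℤˣ) : weight G t (-s) = weight G t s := by
  refine Finset.prod_congr rfl fun e _ => ?_
  induction e with
  | _ x y => simp [Sym2.mul_mk]

/-- The factors of the weight that do not involve the spin at `a`. -/
def restWeight (a : V) (t : ℂ) (s : V → ℤˣ) : ℂ :=
  ∏ e ∈ G.edgeFinset \ G.incidenceFinset a, (1 + t * (e.map fun v => ((s v : ℤ) : ℂ)).mul)

lemma restWeight_flip (a : V) (t : ℂ) (s : V → ℤˣ) :
    restWeight G a t (flip a s) = restWeight G a t s := by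
  refine Finset.prod_congr rfl fun e he => ?_
  rw [Finset.mem_sdiff, G.incidenceFinset_eq_filter] at he
  have ha : a ∉ e := fun h => he.2 (Finset.mem_filter.2 ⟨he.1, h⟩)
  congr 3
  refine Sym2.map_congr fun v hv => ?_
  rw [flip_of_ne (ne_of_mem_of_not_mem hv ha)]

lemma weight_eq (a : V) (t : ℂ) (s : V → ℤˣ) :
    weight G t s = (∏ b ∈ G.neighborFinset a, (1 + t * (((s a : ℤ) : ℂ) * ((s b : ℤ) : ℂ)))) *
      restWeight G a t s := by
  have himg : G.incidenceFinset a = (G.neighborFinset a).image (fun b => s(a, b)) := by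
    ext e
    induction e with
    | _ x y =>
      simp only [SimpleGraph.mem_incidenceFinset, SimpleGraph.mk'_mem_incidenceSet_iff,
        Finset.mem_image, SimpleGraph.mem_neighborFinset, Sym2.eq_iff]
      constructor
      · rintro ⟨h, rfl | rfl⟩
        · exact ⟨y, h, by simp⟩
        · exact ⟨x, h.symm, by simp⟩
      · rintro ⟨b, hb, ⟨rfl, rfl⟩ | ⟨rfl, rfl⟩⟩
        · exact ⟨hb, by simp⟩
        · exact ⟨hb.symm, by simp⟩
  rw [weight, ← Finset.prod_sdiff (G.incidenceFinset_subset a), mul_comm, restWeight]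
  congr 1
  rw [himg, Finset.prod_image]
  · simp [Sym2.mul_mk]
  · intro b _ c _ h
    exact Sym2.congr_right.1 h

/-- The unnormalised expectation value of a product of spins. -/
def moment (t : ℂ) (A : Finset V) : ℂ := ∑ s, spinProd A s * weight G t s

/-- With the other spins fixed, the sum over the spin at `a` replaces it by its conditional mean
`F`, the tanh of the local field, which depends on the neighbours only. Formally, the difference of
the two summands is odd under the flip at `a`. -/
lemma norm_moment_le_mul {t : ℂ} {a : V} {A : Finset V} (ha : a ∈ A)
    (hG : G.degree a * Real.arctan ‖t‖ < Real.pi / 2) {C : ℝ} (hC : ∀ B, ‖moment G t B‖ ≤ C) :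
    ‖moment G t A‖ ≤ Real.tan (G.degree a * Real.arctan ‖t‖) * C := by
  obtain ⟨F, hF, hF2, hF3⟩ := exists_tanh_multiplier t (G.neighborFinset a) hG
  rw [SimpleGraph.card_neighborFinset_eq_degree] at hF
  have hna : ∀ b ∈ G.neighborFinset a, b ≠ a := fun b hb => by
    rintro rfl
    simp at hb
  have key : moment G t A = ∑ s, spinProd (A.erase a) s * (F s * weight G t s) := by
    rw [moment, ← sub_eq_zero, ← Finset.sum_sub_distrib]
    refine sum_eq_zero_of_odd_involution (flip_involutive a) fun s => ?_
    have hsp : ∀ s, spinProd A s = ((s a : ℤ) : ℂ) * spinProd (A.erase a) s :=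
      fun s => (Finset.mul_prod_erase A _ ha).symm
    have hF4 : F (flip a s) = F s := hF3 _ _ fun b hb => flip_of_ne (hna b hb) s
    have hw : ∏ b ∈ G.neighborFinset a,
        (1 + t * (((flip a s a : ℤ) : ℂ) * ((flip a s b : ℤ) : ℂ))) =
        ∏ b ∈ G.neighborFinset a, (1 - t * (((s a : ℤ) : ℂ) * ((s b : ℤ) : ℂ))) :=
      Finset.prod_congr rfl fun b hb => by
        rw [flip_of_ne (hna b hb), flip_self]; push_cast; ring
    rw [hsp, hsp s, weight_eq G a, weight_eq G a t s, hw, hF4, restWeight_flip,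
      spinProd_flip_of_notMem (Finset.notMem_erase a A), flip_self]
    have h2 := hF2 s
    rcases Int.units_eq_one_or (s a) with h | h <;> rw [h] <;> push_cast <;>
      simp only [neg_mul, one_mul, mul_neg, sub_neg_eq_add, ← sub_eq_add_neg]
    · linear_combination -(spinProd (A.erase a) s * restWeight G a t s) * -h2
    · linear_combination (spinProd (A.erase a) s * restWeight G a t s) * h2
  rw [key]
  exact hF _ _ hC _

/-- If the condition `deg * arctan |t| < π / 4` holds, then the partition function
has no zero and the correlations are at most `1`. -/
theorem moment_empty_ne_zero_and_norm_moment_le {t : ℂ} (ht : ‖t‖ < 1)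
    (hG : ∀ a, G.degree a * Real.arctan ‖t‖ < Real.pi / 4) :
    moment G t ∅ ≠ 0 ∧ ∀ A, ‖moment G t A‖ ≤ ‖moment G t ∅‖ := by
  obtain ⟨A₀, -, hA₀⟩ := Finset.exists_max_image (Finset.univ : Finset (Finset V))
    (fun A => ‖moment G t A‖) ⟨∅, Finset.mem_univ _⟩
  have hmax := fun A => hA₀ A (Finset.mem_univ A)
  have hle : ∀ A, ‖moment G t A‖ ≤ ‖moment G t ∅‖ := by
    rcases A₀.eq_empty_or_nonempty with rfl | ⟨a, ha⟩
    · exact hmax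
    · have hpi := Real.pi_pos
      have h0 : 0 ≤ G.degree a * Real.arctan ‖t‖ :=
        mul_nonneg (Nat.cast_nonneg _) (Real.arctan_nonneg.2 (norm_nonneg t))
      have h1 := norm_moment_le_mul G ha (by linarith [hG a]) hmax
      have h2 : Real.tan (G.degree a * Real.arctan ‖t‖) < 1 := by
        rw [← Real.tan_pi_div_four]
        exact Real.tan_lt_tan_of_lt_of_lt_pi_div_two (by linarith) (by linarith) (hG a)
      have h3 : ‖moment G t A₀‖ ≤ 0 := by nlinarith [norm_nonneg (moment G t A₀)]
      exact fun A => ((hmax A).trans h3).trans (norm_nonneg _)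
  refine ⟨fun h0 => ?_, hle⟩
  refine weight_ne_zero G ht 1 (eq_zero_of_sum_spinProd_eq_zero (fun A => ?_) 1)
  have := hle A
  rw [h0, norm_zero] at this
  exact norm_le_zero_iff.1 this

end Graph

/-! ### The radius of convergence -/

lemma tBound_pos : 0 < tBound := by
  have h2 : (1 : ℝ) < √2 := by rw [Real.lt_sqrt] <;> norm_num
  have h3 : √2 < √3 := Real.sqrt_lt_sqrt (by norm_num) (by norm_num)
  exact mul_pos (by linarith) (by linarith)

lemma tBound_lt_one : tBound < 1 := by
  have h2 : (1 : ℝ) < √2 := by rw [Real.lt_sqrt] <;> norm_num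
  have h2' : √2 < 2 := by rw [Real.sqrt_lt'] <;> norm_num
  have h3' : √3 < 2 := by rw [Real.sqrt_lt'] <;> norm_num
  have h3 : √2 < √3 := Real.sqrt_lt_sqrt (by norm_num) (by norm_num)
  unfold tBound
  nlinarith

/-- Two doublings of the angle: the first leads to `2 - √3`, the second to `1 / √3 = tan (π / 6)`.
-/
lemma arctan_tBound : Real.arctan tBound = Real.pi / 24 := by
  have e2 : √2 * √2 = 2 := Real.mul_self_sqrt (by norm_num)
  have e3 : √3 * √3 = 3 := Real.mul_self_sqrt (by norm_num)
  have h0 := tBound_pos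
  have h1 := tBound_lt_one
  have h3' : √3 < 2 := by rw [Real.sqrt_lt'] <;> norm_num
  have h3 : 1 < √3 := by rw [Real.lt_sqrt] <;> norm_num
  have k1 : 2 * tBound / (1 - tBound ^ 2) = 2 - √3 := by
    rw [div_eq_iff (by nlinarith)]
    unfold tBound
    generalize √2 = a at *
    generalize √3 = b at *
    have e4 : (b - a) ^ 2 = 5 - 2 * a * b := by linear_combination e2 + e3
    have e5 : (a - 1) ^ 2 = 3 - 2 * a := by linear_combination e2
    rw [mul_pow, e4, e5]
    linear_combination (-2 + 8 * b - 4 * b ^ 2) * e2 + (6 * a - 8) * e3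
  have k2 : 2 * (2 - √3) / (1 - (2 - √3) ^ 2) = (√3)⁻¹ := by
    rw [inv_eq_one_div, div_eq_div_iff (by nlinarith) (by linarith)]
    linear_combination -e3
  have l1 := Real.two_mul_arctan (x := tBound) (by linarith) h1
  have l2 := Real.two_mul_arctan (x := 2 - √3) (by linarith) (by linarith)
  rw [k1] at l1
  rw [k2, Real.arctan_inv_sqrt_three] at l2
  linarith

/-! ### The torus -/

/-- The six unit vectors of the cubic lattice. -/
def dir (δ : Fin 3 × ℤˣ) : Fin 3 → ℤ := Pi.single δ.1 (δ.2 : ℤ)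

lemma toSite_add (n : ℕ+) (x y : Fin 3 → ℤ) : toSite n (x + y) = toSite n x + toSite n y := by
  ext a; simp [toSite]

lemma toSite_dir (n : ℕ+) (δ : Fin 3 × ℤˣ) :
    toSite n (dir δ) = Pi.single δ.1 ((δ.2 : ℤ) : ZMod n) := by
  ext a
  by_cases h : a = δ.1
  · subst h; simp [toSite, dir]
  · simp [toSite, dir, h]

lemma torus_adj_iff (n : ℕ+) (i k : Site n) :
    (torus n).Adj i k ↔ i ≠ k ∧ ∃ δ, k = i + toSite n (dir δ) := by
  simp only [torus, toSite_dir, Prod.exists]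
  refine and_congr_right fun _ => exists_congr fun a => ?_
  constructor
  · rintro (h | h)
    · refine ⟨-1, ?_⟩
      simp [Pi.single_neg, ← h]
    · refine ⟨1, ?_⟩
      have : (Pi.single a 1 : Site n) = k - i := by rw [← neg_sub, h, neg_neg]
      simp [this]
  · rintro ⟨u, h⟩
    rcases Int.units_eq_one_or u with rfl | rfl
    · right; rw [h]; simp
    · left; rw [h]; simp [Pi.single_neg]

lemma neighborFinset_torus_subset (n : ℕ+) (i : Site n) :
    (torus n).neighborFinset i ⊆ Finset.univ.image fun δ => i + toSite n (dir δ) := by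
  intro k hk
  rw [SimpleGraph.mem_neighborFinset, torus_adj_iff] at hk
  obtain ⟨-, δ, h⟩ := hk
  exact Finset.mem_image.2 ⟨δ, Finset.mem_univ _, h.symm⟩

lemma degree_torus_le (n : ℕ+) (i : Site n) : (torus n).degree i ≤ 6 := by
  rw [← SimpleGraph.card_neighborFinset_eq_degree]
  refine (Finset.card_le_card (neighborFinset_torus_subset n i)).trans ?_
  refine Finset.card_image_le.trans ?_
  simp

/-! ### Correlation functions in the variable `t = tanh (β J)` -/

lemma moment_torus {n : ℕ+} {t : ℂ} (ht : ‖t‖ < tBound) :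
    moment (torus n) t ∅ ≠ 0 ∧ ∀ A, ‖moment (torus n) t A‖ ≤ ‖moment (torus n) t ∅‖ := by
  refine moment_empty_ne_zero_and_norm_moment_le _ (ht.trans tBound_lt_one) fun i => ?_
  have h1 : Real.arctan ‖t‖ < Real.pi / 24 := by
    rw [← arctan_tBound]; exact Real.arctan_strictMono ht
  have h2 : ((torus n).degree i : ℝ) ≤ 6 := by exact_mod_cast degree_torus_le n i
  have h3 := Real.arctan_nonneg.2 (norm_nonneg t)
  nlinarith

/-- The correlation function of the spins at the sites of `A` on the torus, as a function of
`t = tanh (β J)`. -/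
def corr (n : ℕ+) (A : Finset (Fin 3 → ℤ)) (t : ℂ) : ℂ :=
  (∑ σ : Config n, spinProd A (fun x => σ (toSite n x)) * weight (torus n) t σ) /
    moment (torus n) t ∅

lemma corr_empty {n : ℕ+} {t : ℂ} (ht : ‖t‖ < tBound) : corr n ∅ t = 1 :=
  div_self (moment_torus ht).1

lemma norm_corr_le_one (n : ℕ+) (A : Finset (Fin 3 → ℤ)) {t : ℂ} (ht : ‖t‖ < tBound) :
    ‖corr n A t‖ ≤ 1 := by
  -- Different points of `A` may coincide on the torus, so `A` is first reduced to a set of torus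
  -- sites.
  obtain ⟨B, -, hB⟩ := exists_spinProd_eq_prod A (toSite n)
  have h : corr n A t = moment (torus n) t B / moment (torus n) t ∅ := by
    rw [corr, moment]
    congr 1
    exact Finset.sum_congr rfl fun σ _ => by rw [← hB, spinProd]
  rw [h, norm_div]
  exact div_le_one_of_le₀ ((moment_torus ht).2 B) (norm_nonneg _)

lemma differentiableOn_corr (n : ℕ+) (A : Finset (Fin 3 → ℤ)) :
    DifferentiableOn ℂ (corr n A) (Metric.ball 0 tBound) := by
  have hd : ∀ X : Config n → ℂ,
      Differentiable ℂ fun t => ∑ σ : Config n, X σ * weight (torus n) t σ := fun X =>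
    Differentiable.fun_sum fun σ _ => (differentiable_weight (torus n) σ).const_mul (X σ)
  refine (hd _).differentiableOn.div (hd _).differentiableOn fun t ht => ?_
  exact (moment_torus (by simpa using ht)).1

lemma exp_mul_intUnit {K : ℂ} (hK : Complex.cosh K ≠ 0) (u : ℤˣ) :
    Complex.exp (K * ((u : ℤ) : ℂ)) = Complex.cosh K * (1 + Complex.tanh K * ((u : ℤ) : ℂ)) := by
  rw [mul_add, ← mul_assoc, Complex.tanh_eq_sinh_div_cosh, mul_div_cancel₀ _ hK, mul_one]
  rcases Int.units_eq_one_or u with rfl | rfl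
  · simp [Complex.cosh_add_sinh]
  · simp [← sub_eq_add_neg, Complex.cosh_sub_sinh]

lemma exp_energy {n : ℕ+} {β J : ℂ} (hK : Complex.cosh (β * J) ≠ 0) (σ : Config n) :
    Complex.exp (-β * energy n J 0 σ) = Complex.cosh (β * J) ^ (torus n).edgeFinset.card *
      weight (torus n) (Complex.tanh (β * J)) σ := by
  have h : -β * energy n J 0 σ =
      ∑ e ∈ (torus n).edgeFinset, (β * J) * (e.map (spin σ)).mul := by
    rw [energy, ← Finset.mul_sum]; ring
  rw [h, Complex.exp_sum, weight, ← Finset.prod_const, ← Finset.prod_mul_distrib]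
  refine Finset.prod_congr rfl fun e _ => ?_
  induction e with
  | _ x y =>
    have := exp_mul_intUnit hK (σ x * σ y)
    push_cast at this
    simpa only [Sym2.map_mk, Sym2.mul_mk, spin] using this

lemma partitionFunction_ne_zero {n : ℕ+} {β J : ℂ} (hK : Complex.cosh (β * J) ≠ 0)
    (ht : ‖Complex.tanh (β * J)‖ < tBound) : partitionFunction n β J 0 ≠ 0 := by
  have : partitionFunction n β J 0 = Complex.cosh (β * J) ^ (torus n).edgeFinset.card *
      moment (torus n) (Complex.tanh (β * J)) ∅ := by
    simp only [partitionFunction, exp_energy hK, moment, Finset.mul_sum, spinProd_empty, one_mul]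
  rw [this]
  exact mul_ne_zero (pow_ne_zero _ hK) (moment_torus ht).1

lemma expectation_eq_corr {m : ℕ} {j : Fin m → Fin 3 → ℤ} {A : Finset (Fin 3 → ℤ)}
    (hA : ∀ s : (Fin 3 → ℤ) → ℤˣ, ∏ i, ((s (j i) : ℤ) : ℂ) = spinProd A s)
    (n : ℕ+) {β J : ℂ} (hK : Complex.cosh (β * J) ≠ 0) :
    expectation n β J 0 (fun σ => ∏ i, spin σ (toSite n (j i))) =
      corr n A (Complex.tanh (β * J)) := by
  have h : ∀ σ : Config n, ∏ i, spin σ (toSite n (j i)) =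
      spinProd A (fun x => σ (toSite n x)) := fun σ => hA fun x => σ (toSite n x)
  have hc := pow_ne_zero (torus n).edgeFinset.card hK
  simp only [expectation, partitionFunction, h, exp_energy hK, corr, moment, spinProd_empty,
    one_mul, ← Finset.mul_sum, mul_left_comm _ (Complex.cosh (β * J) ^ _)]
  exact mul_div_mul_left _ _ hc

/-! ### Taylor coefficients of bounded holomorphic functions -/

/-- The coefficient of `z ^ k` in the Taylor series of `f` about `0`. -/
def taylorCoeff (f : ℂ → ℂ) (k : ℕ) : ℂ := (k.factorial : ℂ)⁻¹ * iteratedDeriv k f 0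

lemma hasSum_taylorCoeff {f : ℂ → ℂ} {R : ℝ} (hf : DifferentiableOn ℂ f (Metric.ball 0 R))
    {z : ℂ} (hz : ‖z‖ < R) : HasSum (fun k => taylorCoeff f k * z ^ k) (f z) := by
  refine (Complex.hasSum_taylorSeries_on_ball hf (by simpa using hz)).congr_fun fun k => ?_
  rw [taylorCoeff, smul_eq_mul, smul_eq_mul, sub_zero]
  ring

lemma norm_taylorCoeff_mul_pow_le {f : ℂ → ℂ} {r R C : ℝ} (hr : 0 < r) (hrR : r < R)
    (hf : DifferentiableOn ℂ f (Metric.ball 0 R)) (hC : ∀ z, ‖z‖ = r → ‖f z‖ ≤ C) (k : ℕ) :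
    ‖taylorCoeff f k‖ * r ^ k ≤ C := by
  have hd : DiffContOnCl ℂ f (Metric.ball 0 r) :=
    (hf.mono (Metric.closedBall_subset_ball hrR)).diffContOnCl_ball subset_rfl
  have h := Complex.norm_iteratedDeriv_le_of_forall_mem_sphere_norm_le k hr hd
    (fun z hz => hC z (by simpa using hz))
  have hk : (0 : ℝ) < k.factorial := by exact_mod_cast k.factorial_pos
  rw [le_div_iff₀ (pow_pos hr k)] at h
  rw [taylorCoeff, norm_mul, norm_inv, Complex.norm_natCast, mul_assoc, inv_mul_le_iff₀ hk]
  exact h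

/-- Cauchy's estimate on circles of radius `r < R`, followed by `r → R`. -/
lemma norm_taylorCoeff_mul_pow_radius_le {f : ℂ → ℂ} {R C : ℝ} (hR : 0 < R)
    (hf : DifferentiableOn ℂ f (Metric.ball 0 R)) (hC : ∀ z, ‖z‖ < R → ‖f z‖ ≤ C) (k : ℕ) :
    ‖taylorCoeff f k‖ * R ^ k ≤ C := by
  have hlim : Tendsto (fun r : ℝ => ‖taylorCoeff f k‖ * r ^ k) (𝓝[<] R)
      (𝓝 (‖taylorCoeff f k‖ * R ^ k)) :=
    (Continuous.tendsto (by fun_prop) R).mono_left nhdsWithin_le_nhds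
  refine le_of_tendsto hlim ?_
  filter_upwards [Ioo_mem_nhdsLT hR] with r hr
  exact norm_taylorCoeff_mul_pow_le hr.1 hr.2 hf (fun z hz => hC z (hz.trans_lt hr.2)) k

/-- Cauchy's estimate on a circle of small radius `r` bounds the coefficient by `C * r`; then `r →
0`. -/
lemma taylorCoeff_eq_zero_of_isBigO {f : ℂ → ℂ} {R : ℝ} (hR : 0 < R)
    (hf : DifferentiableOn ℂ f (Metric.ball 0 R)) {k : ℕ}
    (h : f =O[𝓝 0] fun z => z ^ (k + 1)) : taylorCoeff f k = 0 := by
  obtain ⟨C, hC⟩ := h.bound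
  obtain ⟨ε, hε, hball⟩ := Metric.eventually_nhds_iff.1 hC
  have key : ∀ᶠ r : ℝ in 𝓝[>] 0, ‖taylorCoeff f k‖ ≤ C * r := by
    filter_upwards [Ioo_mem_nhdsGT (lt_min hR hε)] with r hr
    have hr2 := lt_min_iff.1 hr.2
    have h1 := norm_taylorCoeff_mul_pow_le (C := C * r * r ^ k) hr.1 hr2.1 hf (fun z hz => by
      have := hball (y := z) (by rw [dist_zero_right, hz]; exact hr2.2)
      rw [norm_pow, hz] at this
      rwa [mul_assoc, ← pow_succ']) k
    exact le_of_mul_le_mul_right h1 (pow_pos hr.1 k)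
  have hlim : Tendsto (fun r : ℝ => C * r) (𝓝[>] 0) (𝓝 (C * 0)) :=
    (Continuous.tendsto (by fun_prop) 0).mono_left nhdsWithin_le_nhds
  have h0 := ge_of_tendsto hlim key
  rw [mul_zero] at h0
  exact norm_le_zero_iff.1 h0

lemma taylorCoeff_eq_of_isBigO_sub {f g : ℂ → ℂ} {R : ℝ} (hR : 0 < R)
    (hf : DifferentiableOn ℂ f (Metric.ball 0 R)) (hg : DifferentiableOn ℂ g (Metric.ball 0 R))
    {k : ℕ} (h : (fun z => f z - g z) =O[𝓝 0] fun z => z ^ (k + 1)) :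
    taylorCoeff f k = taylorCoeff g k := by
  have h0 := taylorCoeff_eq_zero_of_isBigO hR (hf.fun_sub hg) h
  have hnhds := Metric.ball_mem_nhds (0 : ℂ) hR
  have hfa : ContDiffAt ℂ k f 0 := (hf.analyticAt hnhds).contDiffAt
  have hga : ContDiffAt ℂ k g 0 := (hg.analyticAt hnhds).contDiffAt
  rw [taylorCoeff, iteratedDeriv_fun_sub hfa hga, mul_sub] at h0
  exact sub_eq_zero.1 h0

/-- Power series with coefficients bounded by `r ^ (-k)` converge uniformly on smaller discs. -/
lemma isUniformSeriesExpansion_of_hasSum {r : ℝ} (hr : 0 < r) {f : WithTop ℕ+ → ℂ → ℂ}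
    {c : WithTop ℕ+ → ℕ → ℂ} (hc : ∀ n k, ‖c n k‖ * r ^ k ≤ 1)
    (hf : ∀ n z, ‖z‖ < r → HasSum (fun k => c n k * z ^ k) (f n z)) :
    IsUniformSeriesExpansion r f c := by
  refine ⟨fun n => ⟨?_, ENNReal.ofReal_pos.2 hr, fun {z} hz => ?_⟩, fun ρ hρ => ?_⟩
  · refine FormalMultilinearSeries.le_radius_of_bound _ 1 fun k => ?_
    rw [FormalMultilinearSeries.ofScalars_norm, Real.coe_toNNReal _ hr.le]
    exact hc n k
  · have hz' : ‖z‖ < r := by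
      rwa [Metric.eball_ofReal, mem_ball_zero_iff] at hz
    rw [zero_add]
    refine (hf n z hz').congr_fun fun k => ?_
    rw [FormalMultilinearSeries.ofScalars_apply_eq, smul_eq_mul]
  · rcases lt_or_ge ρ 0 with h0 | h0
    · rw [Metric.closedBall_eq_empty.2 h0, Set.prod_empty]
      exact tendstoUniformlyOn_empty
    have hu : Summable fun k : ℕ => (ρ / r) ^ k :=
      summable_geometric_of_lt_one (by positivity) ((div_lt_one hr).2 hρ)
    have := tendstoUniformlyOn_tsum_nat hu (s := Set.univ ×ˢ Metric.closedBall (0 : ℂ) ρ)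
      (f := fun k (p : WithTop ℕ+ × ℂ) => c p.1 k * p.2 ^ k) (fun k p hp => by
        have hp2 : ‖p.2‖ ≤ ρ := by simpa using hp.2
        rw [norm_mul, norm_pow, div_pow, le_div_iff₀ (pow_pos hr k)]
        calc ‖c p.1 k‖ * ‖p.2‖ ^ k * r ^ k = (‖c p.1 k‖ * r ^ k) * ‖p.2‖ ^ k := by ring
          _ ≤ 1 * ρ ^ k := mul_le_mul (hc _ _) (pow_le_pow_left₀ (norm_nonneg _) hp2 k)
              (by positivity) zero_le_one
          _ = ρ ^ k := one_mul _)
    refine this.congr_right fun p hp => ?_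
    have hp2 : ‖p.2‖ ≤ ρ := by simpa using hp.2
    exact (hf p.1 p.2 (hp2.trans_lt hρ)).tsum_eq

/-! ### Comparison of `tanh` and `tan` -/

lemma cosh_ne_zero_of_norm_lt {z : ℂ} (hz : ‖z‖ < Real.pi / 2) : Complex.cosh z ≠ 0 := by
  intro h
  rw [← Complex.cos_mul_I, Complex.cos_eq_zero_iff] at h
  obtain ⟨k, hk⟩ := h
  have h1 := congrArg norm hk
  rw [norm_mul, Complex.norm_I, mul_one] at h1
  have h2 : ‖((2 * k + 1) * Real.pi / 2 : ℂ)‖ = |((2 * k + 1 : ℤ) : ℝ)| * Real.pi / 2 := by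
    rw [norm_div, norm_mul, Complex.norm_real, Real.norm_of_nonneg Real.pi_pos.le]
    congr 2
    · rw [← Complex.norm_intCast]; push_cast; rfl
    · simp
  have h3 : (1 : ℝ) ≤ |((2 * k + 1 : ℤ) : ℝ)| := by
    rw [← Int.cast_abs]
    exact_mod_cast Int.one_le_abs (by lia)
  have := Real.pi_pos
  rw [h1, h2] at hz
  nlinarith

lemma hasDerivAt_tanh {z : ℂ} (hz : Complex.cosh z ≠ 0) :
    HasDerivAt Complex.tanh (1 - Complex.tanh z ^ 2) z := by
  have h := (Complex.hasDerivAt_sinh z).fun_div (Complex.hasDerivAt_cosh z) hz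
  have he : Complex.tanh = fun z => Complex.sinh z / Complex.cosh z :=
    funext Complex.tanh_eq_sinh_div_cosh
  rw [he]
  refine h.congr_deriv ?_
  field_simp

/-- Along the ray to `z`, tanh solves `f' = (1 - f ^ 2) * z`, while `tan (s * M)` solves `B' = (1 +
B ^ 2) * M`. The strict inequality `‖z‖ < M` makes the norm of `f'` smaller than `B'` wherever `‖f‖
= B`, so the bound is never crossed. -/
lemma norm_tanh_le_tan {z : ℂ} {M : ℝ} (hz : ‖z‖ < M) (hM : M < Real.pi / 2) :
    ‖Complex.tanh z‖ ≤ Real.tan M := by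
  have hM0 : 0 < M := (norm_nonneg z).trans_lt hz
  have hcosh : ∀ s ∈ Set.Icc (0 : ℝ) 1, Complex.cosh (s * z) ≠ 0 := fun s hs => by
    refine cosh_ne_zero_of_norm_lt ?_
    rw [norm_mul, Complex.norm_real, Real.norm_of_nonneg hs.1]
    nlinarith [norm_nonneg z, hs.2]
  have hcos : ∀ s ∈ Set.Icc (0 : ℝ) 1, 0 < Real.cos (s * M) := fun s hs =>
    Real.cos_pos_of_mem_Ioo ⟨by nlinarith [Real.pi_pos, hs.1], by nlinarith [hs.2]⟩
  have hf : ∀ s ∈ Set.Icc (0 : ℝ) 1, HasDerivAt (fun s : ℝ => Complex.tanh (s * z))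
      ((1 - Complex.tanh (s * z) ^ 2) * z) s := fun s hs => by
    have h1 : HasDerivAt (fun s : ℝ => (s : ℂ) * z) z s := by
      simpa using (Complex.ofRealCLM.hasDerivAt (x := s)).mul_const z
    exact (hasDerivAt_tanh (hcosh s hs)).comp s h1
  have hB : ∀ s ∈ Set.Icc (0 : ℝ) 1, HasDerivAt (fun s : ℝ => Real.tan (s * M))
      ((1 + Real.tan (s * M) ^ 2) * M) s := fun s hs => by
    have h1 : HasDerivAt (fun s : ℝ => s * M) M s := by
      simpa using (hasDerivAt_id s).mul_const M
    have h2 := (Real.hasDerivAt_tan (hcos s hs).ne').comp s h1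
    have h3 := Real.inv_one_add_tan_sq (hcos s hs).ne'
    refine h2.congr_deriv ?_
    rw [one_div, ← h3, inv_inv]
  have key := image_norm_le_of_norm_deriv_right_lt_deriv_boundary' (a := (0 : ℝ)) (b := 1)
    (fun s hs => (hf s hs).continuousAt.continuousWithinAt)
    (fun s hs => (hf s (Set.Ico_subset_Icc_self hs)).hasDerivWithinAt)
    (B := fun s => Real.tan (s * M)) (by simp)
    (fun s hs => (hB s hs).continuousAt.continuousWithinAt)
    (fun s hs => (hB s (Set.Ico_subset_Icc_self hs)).hasDerivWithinAt)
    (fun s _ h => by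
      rw [← h, norm_mul]
      have h1 : ‖1 - Complex.tanh (s * z) ^ 2‖ ≤ 1 + ‖Complex.tanh (s * z)‖ ^ 2 := by
        refine (norm_sub_le _ _).trans ?_
        rw [norm_one, norm_pow]
      calc _ ≤ (1 + ‖Complex.tanh (s * z)‖ ^ 2) * ‖z‖ :=
            mul_le_mul_of_nonneg_right h1 (norm_nonneg z)
        _ < _ := mul_lt_mul_of_pos_left hz (by positivity))
    (Set.right_mem_Icc.2 zero_le_one)
  simpa using key

lemma norm_tanh_lt_of_norm_lt_arctan {z : ℂ} {r : ℝ} (hz : ‖z‖ < Real.arctan r) :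
    Complex.cosh z ≠ 0 ∧ ‖Complex.tanh z‖ < r := by
  have hr := Real.arctan_lt_pi_div_two r
  refine ⟨cosh_ne_zero_of_norm_lt (hz.trans hr), ?_⟩
  obtain ⟨M, hzM, hM⟩ := exists_between hz
  refine (norm_tanh_le_tan hzM (hM.trans hr)).trans_lt ?_
  rw [← Real.tan_arctan r]
  have := norm_nonneg z
  exact Real.tan_lt_tan_of_lt_of_lt_pi_div_two (by linarith [Real.pi_pos]) hr hM

/-! ### Stability of the correlations under enlargement of the torus -/

lemma dir_injective : Function.Injective dir := by
  rintro ⟨a, u⟩ ⟨b, v⟩ h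
  have hab : a = b := by
    by_contra hne
    have := congrFun h a
    simp [dir, hne] at this
  subst hab
  have := congrFun h a
  simp only [dir, Pi.single_eq_same] at this
  rw [Units.ext this]

lemma abs_dir_le (δ : Fin 3 × ℤˣ) (c : Fin 3) : |dir δ c| ≤ 1 := by
  by_cases h : c = δ.1
  · subst h
    rcases Int.units_eq_one_or δ.2 with h | h <;> simp [dir, h]
  · simp [dir, h]

lemma eq_of_toSite_eq {n : ℕ+} {x y : Fin 3 → ℤ} (h : toSite n x = toSite n y)
    (hxy : ∀ c, |x c - y c| < n) : x = y := by
  ext c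
  have h1 : ((y c : ℤ) : ZMod n) = (x c : ℤ) := (congrFun h c).symm
  rw [ZMod.intCast_eq_intCast_iff_dvd_sub] at h1
  exact sub_eq_zero.1 (Int.eq_zero_of_abs_lt_dvd h1 (hxy c))

lemma dir_ne_zero (δ : Fin 3 × ℤˣ) : dir δ ≠ 0 := fun h => by
  have := congrFun h δ.1
  simp [dir] at this

lemma neighborFinset_torus {n : ℕ+} (hn : 3 ≤ (n : ℕ)) (i : Site n) :
    (torus n).neighborFinset i = Finset.univ.image fun δ => i + toSite n (dir δ) := by
  refine (neighborFinset_torus_subset n i).antisymm fun k hk => ?_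
  obtain ⟨δ, -, rfl⟩ := Finset.mem_image.1 hk
  rw [SimpleGraph.mem_neighborFinset, torus_adj_iff]
  refine ⟨fun h => dir_ne_zero δ ?_, δ, rfl⟩
  have h0 : toSite n (dir δ) = toSite n 0 := by
    have : toSite n 0 = 0 := by ext; simp [toSite]
    rw [this]
    exact left_eq_add.1 h
  refine eq_of_toSite_eq h0 fun c => ?_
  have := abs_dir_le δ c
  rw [Pi.zero_apply, sub_zero]
  lia

/-- From side three on, the six directions lead to different neighbours; on the torus of side two
opposite directions coincide. -/
lemma prod_neighborFinset_torus {n : ℕ+} (hn : 3 ≤ (n : ℕ)) (i : Site n) (f : Site n → ℂ) :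
    ∏ k ∈ (torus n).neighborFinset i, f k = ∏ δ, f (i + toSite n (dir δ)) := by
  rw [neighborFinset_torus hn, Finset.prod_image]
  intro δ _ δ' _ h
  refine dir_injective (eq_of_toSite_eq (add_left_cancel h) fun c => ?_)
  have h1 := abs_dir_le δ c
  have h2 := abs_dir_le δ' c
  have h3 := abs_sub (dir δ c) (dir δ' c)
  lia

/-- The sites with odd multiplicity that remain of `A` when the bonds from `a` in the directions
`δ ∈ S` are multiplied to it. -/
def attach (A : Finset (Fin 3 → ℤ)) (a : Fin 3 → ℤ) (S : Finset (Fin 3 × ℤˣ)) :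
    Finset (Fin 3 → ℤ) :=
  symmDiff (symmDiff A (S.image fun δ => a + dir δ)) (if Odd S.card then {a} else ∅)

@[simp] lemma attach_empty (A : Finset (Fin 3 → ℤ)) (a : Fin 3 → ℤ) : attach A a ∅ = A := by
  simp [attach]

lemma spinProd_attach (A : Finset (Fin 3 → ℤ)) (a : Fin 3 → ℤ) (S : Finset (Fin 3 × ℤˣ))
    (s : (Fin 3 → ℤ) → ℤˣ) :
    spinProd (attach A a S) s =
      spinProd A s * ∏ δ ∈ S, ((s a : ℤ) : ℂ) * ((s (a + dir δ) : ℤ) : ℂ) := by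
  have h1 : spinProd (S.image fun δ => a + dir δ) s = ∏ δ ∈ S, ((s (a + dir δ) : ℤ) : ℂ) := by
    rw [spinProd, Finset.prod_image]
    exact fun δ _ δ' _ h => dir_injective (add_left_cancel h)
  have h2 : spinProd (if Odd S.card then {a} else ∅) s = ((s a : ℤ) : ℂ) ^ S.card := by
    split_ifs with h
    · rcases Int.units_eq_one_or (s a) with h' | h' <;> simp [h', h.neg_one_pow]
    · rw [Nat.not_odd_iff_even] at h
      rcases Int.units_eq_one_or (s a) with h' | h' <;> simp [h', h.neg_one_pow]
  rw [attach, spinProd_symmDiff, spinProd_symmDiff, h1, h2, Finset.prod_mul_distrib,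
    Finset.prod_const]
  ring

lemma spinProd_toSite_flip {n : ℕ+} {A : Finset (Fin 3 → ℤ)} {a : Fin 3 → ℤ} (ha : a ∈ A)
    (hinj : ∀ x ∈ A, toSite n x = toSite n a → x = a) (σ : Config n) :
    spinProd A (fun x => flip (toSite n a) σ (toSite n x)) =
      -spinProd A (fun x => σ (toSite n x)) := by
  rw [spinProd, spinProd, ← Finset.mul_prod_erase A _ ha, ← Finset.mul_prod_erase A _ ha,
    flip_self, ← neg_mul]
  congr 1
  · push_cast; rfl
  · refine Finset.prod_congr rfl fun x hx => ?_
    rw [flip_of_ne fun h => (Finset.mem_erase.1 hx).1 (hinj x (Finset.mem_erase.1 hx).2 h)]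

/-- Expanding `∏ (1 - t * σ i * σ k)` over the neighbours gives the sum over `S`. Times the weight,
this product is invariant under the flip at `a`, whereas the product over `A` changes sign, `a`
being the only point of `A` above its torus site. The sets `attach A a S` live in the infinite
lattice, so the relation has the same form for every `n`. -/
lemma sum_corr_attach_eq_zero {n : ℕ+} (hn : 3 ≤ (n : ℕ)) {A : Finset (Fin 3 → ℤ)}
    {a : Fin 3 → ℤ} (ha : a ∈ A) (hinj : ∀ x ∈ A, toSite n x = toSite n a → x = a) (t : ℂ) :
    ∑ S : Finset (Fin 3 × ℤˣ), (-t) ^ S.card * corr n (attach A a S) t = 0 := by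
  simp only [corr, mul_div_assoc', ← Finset.sum_div]
  refine div_eq_zero_iff.2 (Or.inl ?_)
  simp only [Finset.mul_sum]
  rw [Finset.sum_comm]
  set i := toSite n a with hi
  have key : ∀ σ : Config n, ∑ S : Finset (Fin 3 × ℤˣ), (-t) ^ S.card *
      (spinProd (attach A a S) (fun x => σ (toSite n x)) * weight (torus n) t σ) =
      spinProd A (fun x => σ (toSite n x)) *
        ((∏ k ∈ (torus n).neighborFinset i, (1 - t * (((σ i : ℤ) : ℂ) * ((σ k : ℤ) : ℂ)))) *
        (∏ k ∈ (torus n).neighborFinset i, (1 + t * (((σ i : ℤ) : ℂ) * ((σ k : ℤ) : ℂ)))) *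
        restWeight (torus n) i t σ) := by
    intro σ
    have h1 : ∏ k ∈ (torus n).neighborFinset i, (1 - t * (((σ i : ℤ) : ℂ) * ((σ k : ℤ) : ℂ))) =
        ∑ S : Finset (Fin 3 × ℤˣ), (-t) ^ S.card *
          ∏ δ ∈ S, ((σ i : ℤ) : ℂ) * ((σ (toSite n (a + dir δ)) : ℤ) : ℂ) := by
      rw [prod_neighborFinset_torus hn]
      simp only [sub_eq_add_neg, ← neg_mul]
      rw [Finset.prod_one_add, Finset.powerset_univ]
      refine Finset.sum_congr rfl fun S _ => ?_
      rw [Finset.prod_mul_distrib, Finset.prod_const]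
      simp only [toSite_add, hi]
    rw [weight_eq (torus n) i, h1, Finset.sum_mul, Finset.sum_mul, Finset.mul_sum]
    refine Finset.sum_congr rfl fun S _ => ?_
    rw [spinProd_attach]
    ring
  simp only [key]
  refine sum_eq_zero_of_odd_involution (flip_involutive i) fun σ => ?_
  have hk : ∀ k ∈ (torus n).neighborFinset i, flip i σ k = σ k := fun k hk =>
    flip_of_ne (fun h => by subst h; simp at hk) σ
  have h1 : ∏ k ∈ (torus n).neighborFinset i,
      (1 - t * (((flip i σ i : ℤ) : ℂ) * ((flip i σ k : ℤ) : ℂ))) =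
      ∏ k ∈ (torus n).neighborFinset i, (1 + t * (((σ i : ℤ) : ℂ) * ((σ k : ℤ) : ℂ))) :=
    Finset.prod_congr rfl fun k hk' => by
      rw [hk k hk', flip_self]; push_cast; ring
  have h2 : ∏ k ∈ (torus n).neighborFinset i,
      (1 + t * (((flip i σ i : ℤ) : ℂ) * ((flip i σ k : ℤ) : ℂ))) =
      ∏ k ∈ (torus n).neighborFinset i, (1 - t * (((σ i : ℤ) : ℂ) * ((σ k : ℤ) : ℂ))) :=
    Finset.prod_congr rfl fun k hk' => by
      rw [hk k hk', flip_self]; push_cast; ring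
  rw [h1, h2, restWeight_flip, spinProd_toSite_flip ha hinj]
  ring

lemma corr_zero_right {n : ℕ+} {A : Finset (Fin 3 → ℤ)} {a : Fin 3 → ℤ} (ha : a ∈ A)
    (hinj : ∀ x ∈ A, toSite n x = toSite n a → x = a) : corr n A 0 = 0 := by
  refine div_eq_zero_iff.2 (Or.inl ?_)
  refine sum_eq_zero_of_odd_involution (flip_involutive (toSite n a)) fun σ => ?_
  rw [spinProd_toSite_flip ha hinj, weight_zero, weight_zero, neg_mul]

lemma corr_eq_zero_of_odd_card {n : ℕ+} {A : Finset (Fin 3 → ℤ)} (hA : Odd A.card) (t : ℂ) :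
    corr n A t = 0 := by
  refine div_eq_zero_iff.2 (Or.inl ?_)
  refine sum_eq_zero_of_odd_involution (neg_involutive (G := Config n)) fun σ => ?_
  rw [weight_neg]
  simp [spinProd, Finset.prod_neg, hA.neg_one_pow]

lemma corr_sub_isBigO_one (A : Finset (Fin 3 → ℤ)) (n n' : ℕ+) :
    (fun t => corr n A t - corr n' A t) =O[𝓝 0] fun _ => (1 : ℂ) := by
  refine Asymptotics.IsBigO.of_bound 2 ?_
  filter_upwards [Metric.ball_mem_nhds (0 : ℂ) tBound_pos] with t ht
  rw [mem_ball_zero_iff] at ht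
  have h1 := norm_corr_le_one n A ht
  have h2 := norm_corr_le_one n' A ht
  have h3 := norm_sub_le (corr n A t) (corr n' A t)
  rw [norm_one]
  linarith

lemma differentiableAt_corr (n : ℕ+) (A : Finset (Fin 3 → ℤ)) :
    DifferentiableAt ℂ (corr n A) 0 :=
  (differentiableOn_corr n A).differentiableAt (Metric.ball_mem_nhds 0 tBound_pos)

/-- No two coordinates of points of `A` differ by more than `d`. -/
def SpreadLE (A : Finset (Fin 3 → ℤ)) (d : ℕ) : Prop :=
  ∀ x ∈ A, ∀ y ∈ A, ∀ c, |x c - y c| ≤ d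

lemma SpreadLE.attach {A : Finset (Fin 3 → ℤ)} {d : ℕ} (h : SpreadLE A d) {a : Fin 3 → ℤ}
    (ha : a ∈ A) (S : Finset (Fin 3 × ℤˣ)) : SpreadLE (attach A a S) (d + S.card) := by
  have hmem : ∀ x ∈ Ising.attach A a S, x ∈ A ∨ ∃ δ ∈ S, x = a + dir δ := by
    intro x hx
    have hsub : Ising.attach A a S ⊆
        (A ∪ S.image fun δ => a + dir δ) ∪ (if Odd S.card then {a} else ∅) :=
      symmDiff_le_sup.trans (sup_le_sup_right symmDiff_le_sup _)
    have h1 := hsub hx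
    rcases Finset.mem_union.1 h1 with h1 | h1
    · rcases Finset.mem_union.1 h1 with h1 | h1
      · exact Or.inl h1
      · obtain ⟨δ, hδ, rfl⟩ := Finset.mem_image.1 h1
        exact Or.inr ⟨δ, hδ, rfl⟩
    · split_ifs at h1
      · rw [Finset.mem_singleton.1 h1]; exact Or.inl ha
      · simp at h1
  intro x hx y hy c
  push_cast
  rcases hmem x hx with hx | ⟨δ, hδ, rfl⟩ <;> rcases hmem y hy with hy | ⟨δ', hδ', rfl⟩
  · have := h x hx y hy c
    lia
  · have h1 := h x hx a ha c
    have h2 := abs_dir_le δ' c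
    have h3 := Finset.card_pos.2 ⟨δ', hδ'⟩
    rw [Pi.add_apply]
    rw [abs_le] at *
    constructor <;> lia
  · have h1 := h a ha y hy c
    have h2 := abs_dir_le δ c
    have h3 := Finset.card_pos.2 ⟨δ, hδ⟩
    rw [Pi.add_apply]
    rw [abs_le] at *
    constructor <;> lia
  · rw [Pi.add_apply, Pi.add_apply, add_sub_add_left_eq_sub]
    by_cases he : δ = δ'
    · subst he
      rw [sub_self, abs_zero]
      positivity
    -- Two new points may be two apart, but then `S` has at least two elements.
    · have h1 := abs_dir_le δ c
      have h2 := abs_dir_le δ' c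
      have h3 := Finset.one_lt_card.2 ⟨δ, hδ, δ', hδ', he⟩
      rw [abs_le] at *
      constructor <;> lia

/-- On tori of side at least `K + d`, the correlation of sites in a box of edge `d` does not depend
on the size of the torus up to order `t ^ K`. -/
theorem corr_sub_isBigO (K : ℕ) : ∀ {A : Finset (Fin 3 → ℤ)} {d : ℕ}, SpreadLE A d →
    ∀ {n n' : ℕ+}, K + d ≤ n → n ≤ n' →
    (fun t => corr n A t - corr n' A t) =O[𝓝 0] fun t => t ^ K := by
  induction K using Nat.strong_induction_on with
  | _ K ih =>
  intro A d hA n n' hn hnn'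
  have hnn : (n : ℕ) ≤ n' := hnn'
  rcases Nat.eq_zero_or_pos K with rfl | hK
  · simpa using corr_sub_isBigO_one A n n'
  rcases A.eq_empty_or_nonempty with rfl | ⟨a, ha⟩
  · refine Asymptotics.IsBigO.congr' (Asymptotics.isBigO_zero _ _) ?_ EventuallyEq.rfl
    filter_upwards [Metric.ball_mem_nhds (0 : ℂ) tBound_pos] with t ht
    rw [mem_ball_zero_iff] at ht
    rw [corr_empty ht, corr_empty ht, sub_self]
  have hinj : ∀ N : ℕ+, n ≤ N → ∀ x ∈ A, toSite N x = toSite N a → x = a := by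
    intro N hN x hx h
    have hN' : (n : ℕ) ≤ N := hN
    refine eq_of_toSite_eq h fun c => ?_
    have := hA x hx a ha c
    lia
  rcases Nat.even_or_odd A.card with hev | hodd
  swap
  · simp only [corr_eq_zero_of_odd_card hodd, sub_self]
    exact Asymptotics.isBigO_zero _ _
  -- Order one is separate, as the torus may be too small for the recursion; it suffices that both
  -- correlations vanish at `t = 0`.
  rcases Nat.lt_or_ge 1 K with hK1 | hK1
  swap
  · obtain rfl : K = 1 := by lia
    have h0 : ∀ N : ℕ+, n ≤ N → (fun t => corr N A t) =O[𝓝 0] fun t => t ^ 1 := by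
      intro N hN
      have := (differentiableAt_corr N A).isBigO_sub
      simpa [corr_zero_right ha (hinj N hN)] using this
    exact (h0 n le_rfl).sub (h0 n' hnn')
  -- A nonempty set of even size has two different points; hence `d ≥ 1`, and with `K ≥ 2` the side
  -- is at least three, as the recursion requires.
  have hd : 0 < d := by
    have hc : 1 < A.card := by
      have := Finset.card_pos.2 ⟨a, ha⟩
      obtain ⟨k, hk⟩ := hev
      lia
    obtain ⟨x, hx, y, hy, hxy⟩ := Finset.one_lt_card.1 hc
    obtain ⟨c, hc⟩ := Function.ne_iff.1 hxy
    have h1 := hA x hx y hy c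
    have h2 := abs_pos.2 (sub_ne_zero.2 hc)
    lia
  have hrec : ∀ N : ℕ+, n ≤ N → ∀ t, corr N A t =
      -∑ S ∈ Finset.univ.erase (∅ : Finset (Fin 3 × ℤˣ)),
        (-t) ^ S.card * corr N (Ising.attach A a S) t := by
    intro N hN t
    have hN' : (n : ℕ) ≤ N := hN
    have := sum_corr_attach_eq_zero (n := N) (by lia) ha (hinj N hN) t
    rw [← Finset.add_sum_erase _ _ (Finset.mem_univ ∅)] at this
    simp only [Finset.card_empty, pow_zero, one_mul, attach_empty] at this
    exact eq_neg_of_add_eq_zero_left this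
  have hdiff : ∀ t, corr n A t - corr n' A t =
      ∑ S ∈ Finset.univ.erase (∅ : Finset (Fin 3 × ℤˣ)),
        -((-t) ^ S.card * (corr n (Ising.attach A a S) t - corr n' (Ising.attach A a S) t)) := by
    intro t
    rw [hrec n le_rfl, hrec n' hnn', Finset.sum_neg_distrib]
    simp only [mul_sub, Finset.sum_sub_distrib]
    ring
  simp only [hdiff]
  refine Asymptotics.IsBigO.fun_sum fun S hS => ?_
  refine Asymptotics.IsBigO.neg_left ?_
  have hS1 : 0 < S.card := Finset.card_pos.2
    (Finset.nonempty_iff_ne_empty.2 (Finset.ne_of_mem_erase hS))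
  have hpow : (fun t : ℂ => (-t) ^ S.card) =O[𝓝 0] fun t => t ^ S.card :=
    Asymptotics.IsBigO.of_bound 1 (Eventually.of_forall fun t => by simp)
  rcases Nat.lt_or_ge K S.card with hKS | hKS
  · have h1 : (fun t : ℂ => t ^ S.card) =O[𝓝 0] fun t => t ^ K :=
      (Asymptotics.isLittleO_pow_pow hKS).isBigO
    simpa using (hpow.trans h1).mul (corr_sub_isBigO_one (Ising.attach A a S) n n')
  -- The factor `t ^ S.card` pays for the wider box: `(K - S.card) + (d + S.card) = K + d`.
  · have h1 := ih (K - S.card) (by lia) (hA.attach ha S) (n := n) (n' := n') (by lia) hnn'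
    refine (hpow.mul h1).congr_right fun t => ?_
    rw [← pow_add, Nat.add_sub_cancel' hKS]

/-! ### The expansions of the correlations -/

/-- The coefficients of the expansion of the correlation of the sites of `A`, a set in a box of
edge `d`, in powers of `t`; for the infinite lattice they are read off from a large torus. -/
def corrCoeff (A : Finset (Fin 3 → ℤ)) (d : ℕ) : WithTop ℕ+ → ℕ → ℂ
  | (n : ℕ+), k => taylorCoeff (corr n A) k
  | ⊤, k => taylorCoeff (corr (k + d).succPNat A) k

/-- The sum of the power series with the coefficients `corrCoeff A d n`. -/
def corrSeries (A : Finset (Fin 3 → ℤ)) (d : ℕ) (n : WithTop ℕ+) (t : ℂ) : ℂ :=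
  ∑' k, corrCoeff A d n k * t ^ k

variable {A : Finset (Fin 3 → ℤ)} {d : ℕ}

/-- Equality of the coefficients of `t ^ k` needs agreement up to order `k + 1`, hence side at least
`k + 1 + d`. This is also the side of the torus that defines the coefficient for `⊤`. -/
lemma corrCoeff_stable (hA : SpreadLE A d) {n : ℕ+} {k : ℕ} (hk : k + d < n)
    {n' : WithTop ℕ+} (hn : n ≤ n') : corrCoeff A d n k = corrCoeff A d n' k := by
  have key : ∀ {n n' : ℕ+}, k + d < n → n ≤ n' →
      taylorCoeff (corr n A) k = taylorCoeff (corr n' A) k := fun {n n'} hk hn =>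
    taylorCoeff_eq_of_isBigO_sub tBound_pos (differentiableOn_corr n A)
      (differentiableOn_corr n' A) (corr_sub_isBigO (k + 1) hA (by lia) hn)
  induction n' with
  | coe n' => exact key hk (WithTop.coe_le_coe.1 hn)
  | top =>
    refine (key (n := (k + d).succPNat) ?_ ?_).symm
    · rw [Nat.succPNat_coe]; exact Nat.lt_succ_self _
    · rw [← PNat.coe_le_coe, Nat.succPNat_coe]; exact hk

lemma norm_corrCoeff_le (n : WithTop ℕ+) (k : ℕ) : ‖corrCoeff A d n k‖ * tBound ^ k ≤ 1 := by
  have key : ∀ n : ℕ+, ‖taylorCoeff (corr n A) k‖ * tBound ^ k ≤ 1 := fun n =>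
    norm_taylorCoeff_mul_pow_radius_le tBound_pos (differentiableOn_corr n A)
      (fun z hz => norm_corr_le_one n A hz) k
  induction n with
  | coe n => exact key n
  | top => exact key _

lemma norm_corrCoeff_mul_pow_le (n : WithTop ℕ+) (t : ℂ) (k : ℕ) :
    ‖corrCoeff A d n k * t ^ k‖ ≤ (‖t‖ / tBound) ^ k := by
  have hr := tBound_pos
  rw [norm_mul, norm_pow, div_pow, le_div_iff₀ (pow_pos hr k), mul_right_comm]
  exact mul_le_of_le_one_left (by positivity) (norm_corrCoeff_le n k)

lemma summable_pow_div_tBound {t : ℂ} (ht : ‖t‖ < tBound) :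
    Summable fun k : ℕ => (‖t‖ / tBound) ^ k :=
  summable_geometric_of_lt_one (div_nonneg (norm_nonneg t) tBound_pos.le)
    ((div_lt_one tBound_pos).2 ht)

lemma isUniformSeriesExpansion_corrSeries :
    IsUniformSeriesExpansion tBound (corrSeries A d) (corrCoeff A d) :=
  isUniformSeriesExpansion_of_hasSum tBound_pos norm_corrCoeff_le fun n t ht =>
    (Summable.of_norm_bounded (summable_pow_div_tBound ht)
      (norm_corrCoeff_mul_pow_le n t)).hasSum

lemma corrSeries_coe (n : ℕ+) {t : ℂ} (ht : ‖t‖ < tBound) : corrSeries A d n t = corr n A t :=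
  (hasSum_taylorCoeff (differentiableOn_corr n A) ht).tsum_eq

/-- Each coefficient is eventually constant in `n`, and a geometric series dominates all the
expansions. -/
lemma tendsto_corr (hA : SpreadLE A d) {t : ℂ} (ht : ‖t‖ < tBound) :
    Tendsto (fun n : ℕ+ => corr n A t) atTop (𝓝 (corrSeries A d ⊤ t)) := by
  simp only [← corrSeries_coe (d := d) _ ht]
  refine tendsto_tsum_of_dominated_convergence (summable_pow_div_tBound ht) (fun k => ?_)
    (Eventually.of_forall fun n => norm_corrCoeff_mul_pow_le _ t)
  refine tendsto_const_nhds.congr' ?_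
  filter_upwards [eventually_ge_atTop (k + d).succPNat] with n hn
  rw [corrCoeff_stable hA (k := k) (n := n) (n' := ⊤) ?_ le_top]
  rw [← PNat.coe_le_coe, Nat.succPNat_coe] at hn
  exact hn

lemma norm_corrSeries_le_one (hA : SpreadLE A d) (n : WithTop ℕ+) {t : ℂ} (ht : ‖t‖ < tBound) :
    ‖corrSeries A d n t‖ ≤ 1 := by
  induction n with
  | coe n => rw [corrSeries_coe n ht]; exact norm_corr_le_one n A ht
  | top =>
    exact le_of_tendsto (tendsto_corr hA ht).norm
      (Eventually.of_forall fun n => norm_corr_le_one n A ht)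

lemma differentiableOn_corrSeries (n : WithTop ℕ+) :
    DifferentiableOn ℂ (corrSeries A d n) (Metric.ball 0 tBound) := by
  rw [← Metric.eball_ofReal]
  exact (isUniformSeriesExpansion_corrSeries.1 n).differentiableOn

/-- Since tanh maps the disc of radius `arctan tBound` into that of radius `tBound`, the composites
are again holomorphic and bounded by one, and Cauchy's estimate applies anew. -/
lemma isUniformSeriesExpansion_corrSeries_tanh (hA : SpreadLE A d) :
    IsUniformSeriesExpansion (Real.arctan tBound)
      (fun n z => corrSeries A d n (Complex.tanh z))
      (fun n => taylorCoeff fun z => corrSeries A d n (Complex.tanh z)) := by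
  have hr : 0 < Real.arctan tBound := Real.arctan_pos.2 tBound_pos
  have hd : ∀ n, DifferentiableOn ℂ (fun z => corrSeries A d n (Complex.tanh z))
      (Metric.ball 0 (Real.arctan tBound)) := fun n =>
    (differentiableOn_corrSeries n).comp
      (fun z hz => (hasDerivAt_tanh (norm_tanh_lt_of_norm_lt_arctan
        (mem_ball_zero_iff.1 hz)).1).differentiableAt.differentiableWithinAt)
      (fun z hz => mem_ball_zero_iff.2
        (norm_tanh_lt_of_norm_lt_arctan (mem_ball_zero_iff.1 hz)).2)
  exact isUniformSeriesExpansion_of_hasSum hr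
    (fun n k => norm_taylorCoeff_mul_pow_radius_le hr (hd n)
      (fun z hz => norm_corrSeries_le_one hA n (norm_tanh_lt_of_norm_lt_arctan hz).2) k)
    (fun n z hz => hasSum_taylorCoeff (hd n) hz)

lemma spreadLE_boxEdge {m : ℕ} {j : Fin m → Fin 3 → ℤ} (hA : A ⊆ Finset.univ.image j) :
    SpreadLE A (boxEdge j) := by
  intro x hx y hy c
  obtain ⟨i, -, rfl⟩ := Finset.mem_image.1 (hA hx)
  obtain ⟨k, -, rfl⟩ := Finset.mem_image.1 (hA hy)
  have := Finset.le_sup (f := fun p : Fin 3 × Fin m × Fin m =>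
    (j p.2.1 p.1 - j p.2.2 p.1).natAbs) (Finset.mem_univ (c, i, k))
  have h2 : (j i c - j k c).natAbs ≤ boxEdge j := this
  rw [Int.abs_eq_natAbs]
  exact_mod_cast h2

end Ising

end

theorem theorem2 {m : ℕ} (j : Fin m → Fin 3 → ℤ) :
    -- at zero field the finite systems have no zeros and the thermodynamic limit exists
    (∀ β J : ℂ,
      (Complex.cosh (β * J) ≠ 0 ∧ ‖Complex.tanh (β * J)‖ < Ising.tBound) ∨
        ‖β * J‖ < Real.arctan Ising.tBound →
      (∀ n : ℕ+, Ising.partitionFunction n β J 0 ≠ 0) ∧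
      Tendsto (fun n : ℕ+ => Ising.correlation j β J 0 n) atTop
        (𝓝 (Ising.correlation j β J 0 ⊤))) ∧
    -- expansion in powers of `t = tanh (β J)`, and stability of its coefficients
    (∃ (g : WithTop ℕ+ → ℂ → ℂ) (c : WithTop ℕ+ → ℕ → ℂ),
      (∀ (n : WithTop ℕ+) (β J : ℂ), Complex.cosh (β * J) ≠ 0 →
        ‖Complex.tanh (β * J)‖ < Ising.tBound →
        Ising.correlation j β J 0 n = g n (Complex.tanh (β * J))) ∧
      Ising.IsUniformSeriesExpansion Ising.tBound g c ∧
      ∀ (n : ℕ+) (k : ℕ), k + Ising.boxEdge j < n →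
        ∀ n' : WithTop ℕ+, n ≤ n' → c n k = c n' k) ∧
    -- expansion in powers of `β J`
    (∃ (h : WithTop ℕ+ → ℂ → ℂ) (b : WithTop ℕ+ → ℕ → ℂ),
      (∀ (n : WithTop ℕ+) (β J : ℂ), ‖β * J‖ < Real.arctan Ising.tBound →
        Ising.correlation j β J 0 n = h n (β * J)) ∧
      Ising.IsUniformSeriesExpansion (Real.arctan Ising.tBound) h b) := by
  obtain ⟨A, hAj, hA⟩ := Ising.exists_spinProd_eq_prod Finset.univ j
  have hspread := Ising.spreadLE_boxEdge hAj
  have hfin : ∀ (n : ℕ+) (β J : ℂ), Complex.cosh (β * J) ≠ 0 →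
      Ising.correlation j β J 0 n = Ising.corr n A (Complex.tanh (β * J)) :=
    fun n β J hK => Ising.expectation_eq_corr hA n hK
  have hlim : ∀ β J : ℂ, Complex.cosh (β * J) ≠ 0 → ‖Complex.tanh (β * J)‖ < Ising.tBound →
      Tendsto (fun n : ℕ+ => Ising.correlation j β J 0 n) atTop
        (𝓝 (Ising.corrSeries A (Ising.boxEdge j) ⊤ (Complex.tanh (β * J)))) := by
    intro β J hK ht
    simp only [hfin _ β J hK]
    exact Ising.tendsto_corr hspread ht
  have hcorr : ∀ (n : WithTop ℕ+) (β J : ℂ), Complex.cosh (β * J) ≠ 0 →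
      ‖Complex.tanh (β * J)‖ < Ising.tBound → Ising.correlation j β J 0 n =
        Ising.corrSeries A (Ising.boxEdge j) n (Complex.tanh (β * J)) := by
    intro n β J hK ht
    induction n with
    | coe n => rw [hfin n β J hK, Ising.corrSeries_coe n ht]
    | top => exact (hlim β J hK ht).limUnder_eq
  refine ⟨fun β J h => ?_, ⟨Ising.corrSeries A (Ising.boxEdge j),
    Ising.corrCoeff A (Ising.boxEdge j), hcorr, Ising.isUniformSeriesExpansion_corrSeries,
    fun n k hk n' hn => Ising.corrCoeff_stable hspread hk hn⟩,
    ⟨_, _, fun n β J h => ?_, Ising.isUniformSeriesExpansion_corrSeries_tanh hspread⟩⟩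
  · obtain ⟨hK, ht⟩ : Complex.cosh (β * J) ≠ 0 ∧ ‖Complex.tanh (β * J)‖ < Ising.tBound :=
      h.elim id Ising.norm_tanh_lt_of_norm_lt_arctan
    refine ⟨fun n => Ising.partitionFunction_ne_zero hK ht, ?_⟩
    rw [hcorr ⊤ β J hK ht]
    exact hlim β J hK ht
  · obtain ⟨hK, ht⟩ := Ising.norm_tanh_lt_of_norm_lt_arctan h
    exact hcorr n β J hK ht
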